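/- Let $q$ be an indeterminate over $\mathbb{Q}$. For $n\ge 0$ put $[n]_q=\frac{q^n-1}{q-1}$ and $[n]!_q=[1]_q[2]_q\cdots[n]_q$. The $q$-Bernoulli--Carlitz numbers $\beta_n\in\mathbb{Q}(q)$, $n\ge 0$, are the rational fractions determined by $$q\sum_{k=0}^n\binom nk q^k\beta_k-\beta_n=\begin{cases}q-1&\text{if } n=0,\\ 1&\text{if } n=1,\\ 0&\text{if } n>1.\end{cases}$$ Let $\Psi$ be the linear form on polynomials in $x$ with $\Psi(x^n)=\beta_n$ (extended $\mathbb{Q}(q)[z]$-linearly to polynomials in $x$ with coefficients in $\mathbb{Q}(q)[z]$), and let $\beta_n(z)=\Psi\big((z+(z(q-1)+1)x)^n\big)\in\mathbb{Q}(q)[z]$ be the $q$-Bernoulli--Carlitz polynomials. For $a\ge 0$ put $$\operatorname{Asc}(z,a)=\prod_{i=1}^a([i]_q+q^iz),\qquad \operatorname{Desc}(z,a)=\prod_{i=1}^a([i]_q-z).$$ Then for every integer $n\ge 1$ the following identities hold in $\mathbb{Q}(q)$: \begin{align*} \det_{0\le i,j\le n-1}\beta_{i+j}&=(-1)^{\binom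 n2}q^{\binom n3}\prod_{i=1}^{n-1}\frac{[i]!_q^6}{[2i]!_q[2i+1]!_q},\\ \det_{0\le i,j\le n-1}\beta_{i+j+1}&=\frac{(-1)^{\binom{n+1}2}}{[2]_q}q^{\binom{n+1}3}\prod_{i=1}^{n-1}\frac{[i]!_q^3[i+1]!_q^3}{[2i+1]!_q[2i+2]!_q},\\ \det_{0\le i,j\le n-1}\beta_{i+j+2}&=\frac{(-1)^{\binom n2}}{[2]_q[3]_q}q^{\binom{n+2}3}\prod_{i=1}^{n-1}\frac{[i]!_q[i+1]!_q^4[i+2]!_q}{[2i+2]!_q[2i+3]!_q},\\ \det_{0\le i,j\le n-1}\beta_{i+j+3}&=\frac{(-1)^{\binom{n+1}2}}{[3]_q^2[4]_q}q^{\binom{n+2}3}\Big(q^{\binom{n+2}2}+(-1)^n\Big)\prod_{i=1}^{n-1}\frac{[i+1]!_q^3[i+2]!_q^3}{[2i+3]!_q[2i+4]!_q}, \end{align*} and in $\mathbb{Q}(q)[z]$ one has $$\det_{0\le i,j\le n-1}\frac1z\int_0^z\beta_{i+j}(y)\,dy=(-1)^{\binom n2}q^{\binom n3}\prod_{i=1}^{n-1}\frac{[i]!_q^4\operatorname{Asc}(z,i)\operatorname{Desc}(z,i)}{[2i]!_q[2i+1]!_q}.$$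 With the convention that empty determinants and empty products equal $1$, the first and the last identity also hold for $n=0$. -/

import Mathlib

open Polynomial

noncomputable section

namespace QBernoulli

/-- The field `ℚ(q)` of rational fractions in one indeterminate over `ℚ`. -/
abbrev K : Type := RatFunc ℚ

/-- The indeterminate `q` of `ℚ(q)`. -/
def q : K := RatFunc.X

/-- The right-hand side of the defining relations of the `q`-Bernoulli-Carlitz numbers. -/
def rhs (n : ℕ) : K := if n = 0 then q - 1 else if n = 1 then 1 else 0

/-- The `q`-Bernoulli-Carlitz numbers: the relation of index `n`
(see `beta_rel` below) solved for its term of highest index. -/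
def beta (n : ℕ) : K :=
  (rhs n - q * ∑ k : Fin n, (n.choose k : K) * q ^ (k : ℕ) * beta k) / (q ^ (n + 1) - 1)

/-- The `q`-integer `[n]_q = (q ^ n - 1) / (q - 1)`. -/
def qInt (n : ℕ) : K := (q ^ n - 1) / (q - 1)

/-- The `q`-factorial `[n]!_q = [1]_q [2]_q ⋯ [n]_q`. -/
def qFact (n : ℕ) : K := ∏ i ∈ Finset.Icc 1 n, qInt i

/-- The linear form `Ψ` with `Ψ (x ^ n) = β_n`, on polynomials in `x` with coefficients in a
commutative `ℚ(q)`-algebra `R`, extended `R`-linearly from `R = ℚ(q)`. -/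
def Psi (R : Type) [CommRing R] [Algebra K R] : R[X] →ₗ[R] R :=
  Polynomial.lsum fun n => (algebraMap K R (beta n)) • LinearMap.id

/-- The `q`-Bernoulli-Carlitz polynomial `β_n(z) = Ψ ((z + (z (q - 1) + 1) x) ^ n)`, an element of
`ℚ(q)[z]`. Inside the argument of `Ψ` (a polynomial in `x` over `ℚ(q)[z]`) the variable `x` is the
outer `X`, and `z` is `C X`. -/
def betaPoly (n : ℕ) : K[X] :=
  Psi K[X] ((C (X : K[X]) + C ((X : K[X]) * C (q - 1) + 1) * (X : K[X][X])) ^ n)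

/-- The integral `∫_0^z p(y) dy` of a polynomial, as a polynomial in `z`. -/
def integral (p : K[X]) : K[X] := p.sum fun k a => monomial (k + 1) (a / ((k : K) + 1))

/-- The polynomial `(1/z) ∫_0^z p(y) dy`: the integral has no constant term
(`integral_eval_zero`), and `divX` divides it by `z` (`X_mul_mean`). -/
def mean (p : K[X]) : K[X] := (integral p).divX

/-- `Asc(z, a) = ∏_{i=1}^a ([i]_q + q ^ i z)`, as a polynomial in `z`. -/
def Asc (a : ℕ) : K[X] := ∏ i ∈ Finset.Icc 1 a, (C (qInt i) + C (q ^ i) * X)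

/-- `Desc(z, a) = ∏_{i=1}^a ([i]_q - z)`, as a polynomial in `z`. -/
def Desc (a : ℕ) : K[X] := ∏ i ∈ Finset.Icc 1 a, (C (qInt i) - X)

lemma q_pow_sub_one_ne_zero (n : ℕ) : q ^ (n + 1) - 1 ≠ 0 := by
  have h : q ^ (n + 1) - 1 = algebraMap ℚ[X] K (X ^ (n + 1) - C 1) := by
    simp [q]
  rw [h]
  exact RatFunc.algebraMap_ne_zero (X_pow_sub_C_ne_zero (Nat.succ_pos n) 1)

/-- The defining relations `q (q β + 1) ^ n - β ^ n = rhs n`, with the exponents of `β`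
turned into indices after expanding the binomial. -/
theorem beta_rel (n : ℕ) :
    q * (∑ k ∈ Finset.range (n + 1), (n.choose k : K) * q ^ k * beta k) - beta n = rhs n := by
  have h := q_pow_sub_one_ne_zero n
  have hb : beta n * (q ^ (n + 1) - 1) =
      rhs n - q * ∑ k : Fin n, (n.choose k : K) * q ^ (k : ℕ) * beta k := by
    conv_lhs => rw [beta]
    exact div_mul_cancel₀ _ h
  rw [Finset.sum_range_succ, Finset.sum_range]
  simp only [Nat.choose_self, Nat.cast_one, one_mul]
  linear_combination hb

lemma Psi_X_pow (n : ℕ) : Psi K (X ^ n) = beta n := by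
  rw [X_pow_eq_monomial]
  simp [Psi, Polynomial.lsum_apply, Polynomial.sum_monomial_index]

lemma integral_eval_zero (p : K[X]) : (integral p).eval 0 = 0 := by
  simp [integral, Polynomial.sum_def, Polynomial.eval_finsetSum]

lemma derivative_integral (p : K[X]) : derivative (integral p) = p := by
  conv_rhs => rw [← Polynomial.sum_monomial_eq p]
  rw [integral, Polynomial.sum_def, Polynomial.sum_def, derivative_sum]
  refine Finset.sum_congr rfl fun k _ => ?_
  rw [derivative_monomial]
  have h : (k : K) + 1 ≠ 0 := Nat.cast_add_one_ne_zero k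
  simp [div_mul_cancel₀ _ h]

lemma X_mul_mean (p : K[X]) : X * mean p = integral p := by
  have h := Polynomial.X_mul_divX_add (integral p)
  rwa [coeff_zero_eq_eval_zero, integral_eval_zero, C_0, add_zero] at h

end QBernoulli

end

/-!
The sequence of means `(1/z) ∫_0^z β_m(y) dy` is the moment sequence of a linear form `meanForm`
on polynomials in `x`. Integrating the relations that define the `β_m` gives `X_mul_meanForm`: in
the variable `u = 1 + (q - 1) x`, this form is the normalised Jackson `q`-integral between `1` and
`W = 1 + (q - 1) z`, that is, the moment functional of the big `q`-Legendre polynomials. Hence it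
annihilates the `q`-differences of polynomials vanishing at both ends (`meanForm_eq_zero`).

Instead of the orthogonal polynomials, the proof uses the two triangular families
`p_i = ∏_{k ≤ i} ([k]_q + q ^ k x)` and `r_j = ∏_{k ≤ j} ([k]_q + q ^ k x - z)`. Applying
`meanForm_eq_zero` to `x p_i (x - z) r_j`, with the `q`-Leibniz rule, gives first order recurrences
for the value at `p_i r_j`, and so a finite `q`-beta integral (`meanForm_ascX_mul_ascXSub`):
this value is `[i]!_q Asc(z, i) [j]!_q Desc(z, j) / [i + j + 1]!_q`. The value at `x p_i r_j` has a
similar form with `[i + j + 2]!_q`. Changing bases (`det_apply_mul_eq`), the Hankel determinants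
of the means and of the means with shifted index become those of inverse `q`-factorials
(`hankelDet_inv_qFact`). Setting `z = 0` in the results gives the determinants of `β_{i+j}` and
`β_{i+j+1}`.

The Desnanot-Jacobi identity, applied to Hankel matrices (`hankelDet_condensation`), links the
determinants of `s_{i+j}`, `s_{i+j+1}` and `s_{i+j+2}`. It serves three times: for the inverse
`q`-factorials, for `β_{i+j+2}`, and for `β_{i+j+3}`. Each time the quotient of the determinants of
two consecutive shifts is known in closed form, and condensation reduces to an identity between
`q`-integers.
-/

noncomputable section

namespace QBernoulli

/-! ### Determinants: condensation and change of basis -/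

section Determinants

open Matrix

variable {R : Type*} [CommRing R]

/-- The case of two border indices of Jacobi's theorem on complementary minors of the adjugate,
for a matrix whose determinant can be cancelled: multiply the matrix by its adjugate with the columns
of the central block replaced by those of the identity. -/
lemma det_mul_det_toBlocks₁₁_of_isLeftRegular {m : Type*} [Fintype m] [DecidableEq m]
    (A : Matrix (m ⊕ Fin 2) (m ⊕ Fin 2) R) (hA : IsLeftRegular A.det) :
    A.det * A.toBlocks₁₁.det = A.adjugate.toBlocks₂₂.det := by
  have hmul := A.mul_adjugate
  rw [← fromBlocks_toBlocks A.adjugate] at hmul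
  nth_rw 1 [← fromBlocks_toBlocks A] at hmul
  rw [fromBlocks_multiply, ← fromBlocks_one, fromBlocks_smul, fromBlocks_inj] at hmul
  obtain ⟨-, h12, -, h22⟩ := hmul
  have h : A * fromBlocks 1 A.adjugate.toBlocks₁₂ 0 A.adjugate.toBlocks₂₂ =
      fromBlocks A.toBlocks₁₁ 0 A.toBlocks₂₁ (A.det • 1) := by
    nth_rw 1 [← fromBlocks_toBlocks A]
    rw [fromBlocks_multiply, h12, h22]
    simp
  have hdet := congrArg det h
  rw [det_mul, det_fromBlocks_zero₂₁, det_fromBlocks_zero₁₂, det_one, one_mul, det_smul,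
    det_one, mul_one, Fintype.card_fin] at hdet
  apply hA
  simp only
  rw [hdet]
  ring

lemma det_mul_det_toBlocks₁₁ {m : Type*} [Fintype m] [DecidableEq m]
    (A : Matrix (m ⊕ Fin 2) (m ⊕ Fin 2) R) :
    A.det * A.toBlocks₁₁.det = A.adjugate.toBlocks₂₂.det := by
  -- The identity is polynomial in the entries: it suffices to prove it for the generic matrix.
  let G : Matrix (m ⊕ Fin 2) (m ⊕ Fin 2) (MvPolynomial ((m ⊕ Fin 2) × (m ⊕ Fin 2)) ℤ) :=
    mvPolynomialX (m ⊕ Fin 2) (m ⊕ Fin 2) ℤ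
  have hG := det_mul_det_toBlocks₁₁_of_isLeftRegular G
    (IsLeftCancelMulZero.mul_left_cancel_of_ne_zero (det_mvPolynomialX_ne_zero (m ⊕ Fin 2) ℤ))
  let φ := (MvPolynomial.aeval (R := ℤ)
    fun ij : (m ⊕ Fin 2) × (m ⊕ Fin 2) => A ij.1 ij.2).toRingHom
  have hφ : φ.mapMatrix G = A := mvPolynomialX_mapMatrix_aeval ℤ A
  have h := congrArg φ hG
  rw [map_mul, RingHom.map_det, RingHom.map_det, RingHom.map_det, hφ] at h
  have h1 : φ.mapMatrix G.toBlocks₁₁ = A.toBlocks₁₁ := by rw [← hφ]; rfl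
  have h2 : φ.mapMatrix G.adjugate.toBlocks₂₂ = A.adjugate.toBlocks₂₂ := by
    rw [← hφ, ← RingHom.map_adjugate]; rfl
  rwa [h1, h2] at h

/-- The indices of a square matrix of size `n + 2`, split into the `n` inner ones
and the two outer ones. -/
def innerOuterEquiv (n : ℕ) : Fin n ⊕ Fin 2 ≃ Fin (n + 2) :=
  Equiv.ofBijective (Sum.elim (fun i => i.succ.castSucc) ![0, Fin.last (n + 1)]) <| by
    rw [Fintype.bijective_iff_injective_and_card]
    refine ⟨?_, by simp⟩
    rintro (i | i) (j | j) h
    · simpa using h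
    · fin_cases j <;> simp [Fin.ext_iff] at h <;> omega
    · fin_cases i <;> simp [Fin.ext_iff] at h <;> omega
    · fin_cases i <;> fin_cases j <;> simp [Fin.ext_iff] at h ⊢

/-- The Desnanot-Jacobi identity. -/
theorem det_mul_det_inner {n : ℕ} (A : Matrix (Fin (n + 2)) (Fin (n + 2)) R) :
    A.det * (A.submatrix (fun i : Fin n => i.succ.castSucc) fun i => i.succ.castSucc).det =
      (A.submatrix Fin.castSucc Fin.castSucc).det * (A.submatrix Fin.succ Fin.succ).det -
        (A.submatrix Fin.castSucc Fin.succ).det * (A.submatrix Fin.succ Fin.castSucc).det := by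
  have h := det_mul_det_toBlocks₁₁ (A.submatrix (innerOuterEquiv n) (innerOuterEquiv n))
  rw [det_submatrix_equiv_self, adjugate_submatrix_equiv_self, det_fin_two] at h
  have h0 : innerOuterEquiv n (Sum.inr 0) = 0 := rfl
  have h1 : innerOuterEquiv n (Sum.inr 1) = Fin.last (n + 1) := rfl
  simp only [toBlocks₂₂, of_apply, submatrix_apply, h0, h1,
    adjugate_fin_succ_eq_det_submatrix, Fin.succAbove_zero, Fin.succAbove_last] at h
  have h11 : (A.submatrix (innerOuterEquiv n) (innerOuterEquiv n)).toBlocks₁₁ =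
      A.submatrix (fun i : Fin n => i.succ.castSucc) fun i => i.succ.castSucc := rfl
  rw [h11] at h
  rw [h]
  have hs : ((-1 : R) ^ (n + 1)) * (-1) ^ (n + 1) = 1 := by
    rw [← mul_pow]; simp
  have hs2 : ((-1 : R) ^ (n + 1 + (n + 1))) = 1 := by rw [pow_add, hs]
  simp only [Fin.val_zero, Fin.val_last, add_zero, zero_add, pow_zero, one_mul, hs2]
  linear_combination -(A.submatrix Fin.castSucc Fin.succ).det *
    (A.submatrix Fin.succ Fin.castSucc).det * hs

/-- The Hankel determinant of order `n` of a sequence. -/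
def hankelDet (s : ℕ → R) (n : ℕ) : R := det (of fun i j : Fin n => s (i + j))

@[simp] lemma hankelDet_zero (s : ℕ → R) : hankelDet s 0 = 1 := det_isEmpty

/-- Condensation of Hankel determinants. -/
theorem hankelDet_condensation (s : ℕ → R) (n : ℕ) :
    hankelDet s (n + 2) * hankelDet (fun m => s (m + 2)) n =
      hankelDet s (n + 1) * hankelDet (fun m => s (m + 2)) (n + 1) -
        hankelDet (fun m => s (m + 1)) (n + 1) ^ 2 := by
  have h := det_mul_det_inner (of fun i j : Fin (n + 2) => s (i + j))
  have h1 : ∀ k (f g : Fin k → Fin (n + 2)) (a : ℕ), (∀ i j, (f i : ℕ) + g j = i + j + a) →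
      ((of fun i j : Fin (n + 2) => s (i + j)).submatrix f g).det =
        hankelDet (fun m => s (m + a)) k := by
    intro k f g a hfg
    refine congrArg det ?_
    ext i j
    simp only [of_apply, submatrix_apply, hfg]
  rw [h1 _ _ _ 2 (by intro i j; simp only [Fin.val_castSucc, Fin.val_succ]; omega),
    h1 _ _ _ 0 (by intro i j; simp only [Fin.val_castSucc]; omega),
    h1 _ _ _ 2 (by intro i j; simp only [Fin.val_succ]; omega),
    h1 _ _ _ 1 (by intro i j; simp only [Fin.val_castSucc, Fin.val_succ]; omega),
    h1 _ _ _ 1 (by intro i j; simp only [Fin.val_castSucc, Fin.val_succ]; omega)] at h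
  rw [pow_two]
  exact h

lemma map_hankelDet {S : Type*} [CommRing S] (f : R →+* S) (s : ℕ → R) (n : ℕ) :
    f (hankelDet s n) = hankelDet (fun m => f (s m)) n := by
  rw [hankelDet, RingHom.map_det]; rfl

/-- The moment matrix of a linear form in two triangular families of polynomials has, up to the
leading coefficients, the determinant of the Hankel matrix of its moments. -/
theorem det_apply_mul_eq (L : R[X] →ₗ[R] R) (p r : ℕ → R[X])
    (hp : ∀ i, (p i).natDegree ≤ i) (hr : ∀ i, (r i).natDegree ≤ i) (n : ℕ) :
    det (of fun i j : Fin n => L (p i * r j)) =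
      (∏ i ∈ Finset.range n, (p i).coeff i * (r i).coeff i) * hankelDet (fun m => L (X ^ m)) n := by
  have expand : ∀ (f : ℕ → R[X]) (_ : ∀ i, (f i).natDegree ≤ i) (i : Fin n),
      f i = ∑ k : Fin n, (f i).coeff k • X ^ (k : ℕ) := by
    intro f hf i
    conv_lhs => rw [(f i).as_sum_range' n (lt_of_le_of_lt (hf i) i.2), Finset.sum_range]
    exact Finset.sum_congr rfl fun k _ => by rw [← smul_X_eq_monomial]
  have key : (of fun i j : Fin n => L (p i * r j)) =
      (of fun i k : Fin n => (p i).coeff k) * (of fun i j : Fin n => L (X ^ ((i : ℕ) + j))) *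
        (of fun j k : Fin n => (r j).coeff k)ᵀ := by
    ext i j
    simp only [mul_apply, of_apply, transpose_apply]
    nth_rw 1 [expand p hp i, expand r hr j]
    rw [Finset.sum_mul_sum]
    simp only [map_sum, Finset.sum_mul, smul_mul_smul_comm, map_smul, ← pow_add, smul_eq_mul]
    rw [Finset.sum_comm]
    exact Finset.sum_congr rfl fun _ _ => Finset.sum_congr rfl fun _ _ => by ring
  have tri : ∀ (f : ℕ → R[X]) (_ : ∀ i, (f i).natDegree ≤ i),
      det (of fun i k : Fin n => (f i).coeff k) = ∏ i ∈ Finset.range n, (f i).coeff i := by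
    intro f hf
    rw [det_of_isLowerTriangular, Finset.prod_range]
    · rfl
    · intro i k hik
      exact coeff_eq_zero_of_natDegree_lt (lt_of_le_of_lt (hf i) hik)
  rw [key, det_mul, det_mul, det_transpose, tri p hp, tri r hr, Finset.prod_mul_distrib, hankelDet]
  ring

end Determinants

/-! ### `q`-integers and `q`-factorials -/

lemma q_sub_one_ne_zero : q - 1 ≠ 0 := by simpa using q_pow_sub_one_ne_zero 0

lemma q_ne_zero : q ≠ 0 := RatFunc.X_ne_zero

lemma q_pow_eq (n : ℕ) : q ^ n = 1 + (q - 1) * qInt n := by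
  rw [qInt, mul_div_cancel₀ _ q_sub_one_ne_zero]; ring

lemma qInt_add (m n : ℕ) : qInt (m + n) = qInt m + q ^ m * qInt n := by
  simp only [qInt]
  field_simp [q_sub_one_ne_zero]
  ring

@[simp] lemma qInt_one : qInt 1 = 1 := by simp [qInt, div_self q_sub_one_ne_zero]

lemma qInt_succ (n : ℕ) : qInt (n + 1) = qInt n + q ^ n := by simp [qInt_add]

lemma qInt_succ_ne_zero (n : ℕ) : qInt (n + 1) ≠ 0 :=
  div_ne_zero (q_pow_sub_one_ne_zero n) q_sub_one_ne_zero

@[simp] lemma qFact_zero : qFact 0 = 1 := by simp [qFact]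

lemma qFact_succ (n : ℕ) : qFact (n + 1) = qFact n * qInt (n + 1) := by
  rw [qFact, qFact, Finset.prod_Icc_succ_top (by omega)]

@[simp] lemma qFact_one : qFact 1 = 1 := by simp [qFact]

lemma qFact_ne_zero (n : ℕ) : qFact n ≠ 0 := by
  induction n with
  | zero => simp
  | succ n ih => rw [qFact_succ]; exact mul_ne_zero ih (qInt_succ_ne_zero n)

lemma Asc_succ (a : ℕ) :
    Asc (a + 1) = Asc a * (C (qInt (a + 1)) + C (q ^ (a + 1)) * X) := by
  rw [Asc, Asc, Finset.prod_Icc_succ_top (by omega)]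

lemma Desc_succ (a : ℕ) : Desc (a + 1) = Desc a * (C (qInt (a + 1)) - X) := by
  rw [Desc, Desc, Finset.prod_Icc_succ_top (by omega)]

lemma eval_zero_Asc (a : ℕ) : (Asc a).eval 0 = qFact a := by
  simp [Asc, qFact, eval_prod]

lemma eval_zero_Desc (a : ℕ) : (Desc a).eval 0 = qFact a := by
  simp [Desc, qFact, eval_prod]

/-! ### Functional equations -/

/-- The relations defining the numbers `β_n`, as a functional equation for `Ψ`. -/
lemma Psi_comp_sub (h : K[X][X]) :
    C q * Psi K[X] (h.comp (1 + C (C q) * X)) - Psi K[X] h =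
      C (q - 1) * h.eval 0 + (derivative h).eval 0 := by
  have hX : ∀ n, Psi K[X] (X ^ n) = C (beta n) := by
    intro n
    rw [X_pow_eq_monomial]
    simp [Psi, Polynomial.lsum_apply, Polynomial.sum_monomial_index]
  induction h using Polynomial.induction_on' with
  | add f g hf hg =>
    simp only [add_comp, map_add, eval_add]
    linear_combination hf + hg
  | monomial n a =>
    have hT : Psi K[X] ((1 + C (C q) * X) ^ n) =
        C (∑ k ∈ Finset.range (n + 1), (n.choose k : K) * q ^ k * beta k) := by
      rw [add_comm, add_pow, map_sum, map_sum]
      refine Finset.sum_congr rfl fun k _ => ?_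
      have : (C (C q) * X) ^ k * 1 ^ (n - k) * ((n.choose k : ℕ) : K[X][X]) =
          ((C (q ^ k) * C (n.choose k : K) : K[X]) • X ^ k : K[X][X]) := by
        rw [smul_eq_C_mul]
        simp only [mul_pow, one_pow, map_mul, map_pow, map_natCast]
        ring
      rw [this, map_smul, hX, smul_eq_mul]
      simp only [map_mul, map_pow]
      ring
    have hrhs : C (rhs n) = C (q - 1) * (X ^ n : K[X][X]).eval 0 +
        (derivative (X ^ n : K[X][X])).eval 0 := by
      rcases n with _ | _ | n
      · simp [rhs]
      · simp [rhs]
      · simp [rhs]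
    rw [← C_mul_X_pow_eq_monomial, ← smul_eq_C_mul a, smul_comp, map_smul, map_smul, pow_comp,
      X_comp, hT, hX, derivative_smul, eval_smul, eval_smul]
    have hb := congrArg (C : K → K[X]) (beta_rel n)
    rw [hrhs, map_sub, map_mul] at hb
    simp only [smul_eq_mul]
    linear_combination a * hb

/-- The functional equation of `Ψ` at `(z + (z (q - 1) + 1) x) ^ n`. -/
lemma betaPoly_rel (n : ℕ) :
    C q * (∑ k ∈ Finset.range (n + 1), C ((n.choose k : K) * q ^ k) * betaPoly k) - betaPoly n =
      derivative ((C (q - 1) * X + 1) * X ^ n) := by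
  have h := Psi_comp_sub ((C (X : K[X]) + C ((X : K[X]) * C (q - 1) + 1) * (X : K[X][X])) ^ n)
  have hT : ((C (X : K[X]) + C ((X : K[X]) * C (q - 1) + 1) * (X : K[X][X])) ^ n).comp
      (1 + C (C q) * X) = ∑ k ∈ Finset.range (n + 1), (C ((n.choose k : K) * q ^ k) : K[X]) •
        (C (X : K[X]) + C ((X : K[X]) * C (q - 1) + 1) * (X : K[X][X])) ^ k := by
    have : ((C (X : K[X]) + C ((X : K[X]) * C (q - 1) + 1) * (X : K[X][X])) ^ n).comp
      (1 + C (C q) * X) = (C (C q) * (C (X : K[X]) +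
        C ((X : K[X]) * C (q - 1) + 1) * (X : K[X][X])) + 1) ^ n := by
      simp only [pow_comp, add_comp, mul_comp, C_comp, X_comp]
      simp only [map_add, map_sub, map_mul, map_one]
      congr 1
      ring
    rw [this, add_pow]
    refine Finset.sum_congr rfl fun k _ => ?_
    rw [smul_eq_C_mul]
    simp only [mul_pow, one_pow, map_mul, map_pow, map_natCast]
    ring
  rw [hT, map_sum] at h
  simp only [map_smul, smul_eq_mul] at h
  simp only [betaPoly]
  rw [h]
  simp [derivative_pow]
  ring

/-- The linear form on polynomials in `x` over `ℚ(q)[z]` whose moments are the means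
`(1/z) ∫_0^z β_n(y) dy`. -/
def meanForm : K[X][X] →ₗ[K[X]] K[X] :=
  Polynomial.lsum fun n => mean (betaPoly n) • LinearMap.id

lemma meanForm_X_pow (n : ℕ) : meanForm (X ^ n) = mean (betaPoly n) := by
  rw [X_pow_eq_monomial]
  simp [meanForm, Polynomial.lsum_apply, Polynomial.sum_monomial_index]

/-- Integrating `betaPoly_rel` from `0` to `z`. In the variable `u = 1 + (q - 1) x`, with
`W = 1 + (q - 1) z`, it says that `meanForm` is the normalised Jackson integral from `1` to `W`,
with moments `(W ^ (n + 1) - 1) / ((W - 1) [n + 1]_q)`. -/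
lemma X_mul_meanForm (f : K[X][X]) :
    X * meanForm (C (C q) * f.comp (1 + C (C q) * X) - f) =
      (C (q - 1) * X + 1) * f.eval X - f.eval 0 := by
  induction f using Polynomial.induction_on' with
  | add f g hf hg =>
    simp only [add_comp, eval_add] at hf hg ⊢
    rw [mul_add, add_sub_add_comm, map_add, mul_add, hf, hg]
    ring
  | monomial n a =>
    have hT : meanForm ((1 + C (C q) * X) ^ n) =
        ∑ k ∈ Finset.range (n + 1), C ((n.choose k : K) * q ^ k) * mean (betaPoly k) := by
      rw [add_comm, add_pow, map_sum]
      refine Finset.sum_congr rfl fun k _ => ?_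
      have : (C (C q) * X) ^ k * 1 ^ (n - k) * ((n.choose k : ℕ) : K[X][X]) =
          ((C ((n.choose k : K) * q ^ k) : K[X]) • X ^ k : K[X][X]) := by
        rw [smul_eq_C_mul]
        simp only [mul_pow, one_pow, map_mul, map_pow, map_natCast]
        ring
      rw [this, map_smul, meanForm_X_pow, smul_eq_mul]
    have key : C q * (∑ k ∈ Finset.range (n + 1),
        C ((n.choose k : K) * q ^ k) * integral (betaPoly k)) - integral (betaPoly n) =
        (C (q - 1) * X + 1) * X ^ n - (X ^ n : K[X]).eval (0 : K) • 1 := by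
      rw [← sub_eq_zero]
      have hd : derivative (C q * (∑ k ∈ Finset.range (n + 1),
          C ((n.choose k : K) * q ^ k) * integral (betaPoly k)) - integral (betaPoly n) -
          ((C (q - 1) * X + 1) * X ^ n - (X ^ n : K[X]).eval (0 : K) • 1)) = 0 := by
        rw [derivative_sub, derivative_sub, derivative_C_mul, derivative_sum, derivative_sub,
          derivative_integral, ← betaPoly_rel, derivative_smul, derivative_one]
        simp only [derivative_C_mul, derivative_integral]
        simp
      rw [eq_C_of_natDegree_eq_zero (derivative_eq_zero.mp hd),
        coeff_zero_eq_eval_zero]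
      simp [eval_finsetSum, integral_eval_zero]
    have hmon : C (C q) * (monomial n a).comp (1 + C (C q) * X) - monomial n a =
        a • ((C q : K[X]) • (1 + C (C q) * X) ^ n - X ^ n) := by
      rw [← C_mul_X_pow_eq_monomial, mul_comp, C_comp, pow_comp, X_comp]
      simp only [smul_eq_C_mul]
      ring
    rw [hmon, map_smul, map_sub, map_smul, hT, meanForm_X_pow, eval_monomial, eval_monomial]
    simp only [smul_eq_mul]
    simp only [← X_mul_mean] at key
    have h0 : ((X ^ n : K[X]).eval (0 : K) • 1 : K[X]) = 0 ^ n := by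
      rw [smul_eq_C_mul]; simp
    have hsum : ∑ k ∈ Finset.range (n + 1),
        C ((n.choose k : K) * q ^ k) * (X * mean (betaPoly k)) =
        X * ∑ k ∈ Finset.range (n + 1), C ((n.choose k : K) * q ^ k) * mean (betaPoly k) := by
      rw [Finset.mul_sum]
      exact Finset.sum_congr rfl fun k _ => by ring
    rw [h0, hsum] at key
    linear_combination a * key

/-! ### The two triangular families -/

/-- `meanForm` annihilates the `q`-differences of the polynomials that vanish at both ends `0` and
`z` of the interval, the `q`-difference of `g` being the quotient of `g (1 + q x) - g x`
by `1 + (q - 1) x`. -/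
lemma meanForm_eq_zero {F g : K[X][X]}
    (hF : (1 + C (C (q - 1)) * X) * F = g.comp (1 + C (C q) * X) - g)
    (h0 : g.eval 0 = 0) (hz : g.eval X = 0) : meanForm F = 0 := by
  -- Divide `g`, up to its value at the zero of `u = 1 + (q - 1) x`, by `u`.
  set u : K[X][X] := 1 + C (C (q - 1)) * X with hu
  obtain ⟨f, c, hf⟩ : ∃ (f : K[X][X]) (c : K[X]), g = C c + u * f := by
    obtain ⟨f, hf⟩ := X_sub_C_dvd_sub_C_eval (a := (C (-1 / (q - 1)) : K[X])) (p := g)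
    refine ⟨C (C (1 / (q - 1))) * f, g.eval (C (-1 / (q - 1))), ?_⟩
    have h1 : (C (C (q - 1)) * C (C (1 / (q - 1))) : K[X][X]) = 1 := by
      rw [← C_mul, ← C_mul, mul_one_div_cancel q_sub_one_ne_zero, C_1, C_1]
    have h2 : (C (C (-1 / (q - 1))) : K[X][X]) = -C (C (1 / (q - 1))) := by
      rw [neg_div, C_neg, C_neg]
    rw [h2] at hf
    linear_combination hf - X * f * h1
  have hu0 : u ≠ 0 := fun h => by
    have := congrArg (eval 0) h
    simp [hu] at this
  have huT : u.comp (1 + C (C q) * X) = C (C q) * u := by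
    simp only [hu, add_comp, mul_comp, C_comp, X_comp, one_comp]
    simp only [map_sub, map_one]
    ring
  have hFf : F = C (C q) * f.comp (1 + C (C q) * X) - f := by
    apply mul_left_cancel₀ hu0
    rw [hF, hf, add_comp, mul_comp, C_comp, huT]
    ring
  have hL := X_mul_meanForm f
  rw [← hFf] at hL
  rw [hf] at h0 hz
  simp only [hu, eval_add, eval_mul, eval_C, eval_one, eval_X] at h0 hz
  apply mul_left_cancel₀ (X_ne_zero (R := K))
  linear_combination hL + hz - h0

/-- The polynomial `∏_{k=1}^i ([k]_q + q ^ k x)` in `x`. -/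
def ascX (i : ℕ) : K[X][X] :=
  ∏ k ∈ Finset.range i, (C (C (q ^ (k + 1))) * X + C (C (qInt (k + 1))))

/-- The polynomial `∏_{k=1}^j ([k]_q + q ^ k x - z)` in `x`. -/
def ascXSub (j : ℕ) : K[X][X] :=
  ∏ k ∈ Finset.range j, (C (C (q ^ (k + 1))) * X + C (C (qInt (k + 1)) - X))

@[simp] lemma ascX_zero : ascX 0 = 1 := by simp [ascX]

@[simp] lemma ascXSub_zero : ascXSub 0 = 1 := by simp [ascXSub]

lemma ascX_succ (i : ℕ) :
    ascX (i + 1) = ascX i * (C (C (q ^ (i + 1))) * X + C (C (qInt (i + 1)))) :=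
  Finset.prod_range_succ _ _

lemma ascXSub_succ (j : ℕ) :
    ascXSub (j + 1) = ascXSub j * (C (C (q ^ (j + 1))) * X + C (C (qInt (j + 1)) - X)) :=
  Finset.prod_range_succ _ _

lemma X_mul_ascX_comp (i : ℕ) : (X * ascX i).comp (1 + C (C q) * X) = ascX (i + 1) := by
  induction i with
  | zero => simp [ascX, add_comm]
  | succ i ih =>
    rw [ascX_succ, ← mul_assoc, mul_comp, ih, ascX_succ (i + 1), qInt_succ (i + 1)]
    simp only [add_comp, mul_comp, C_comp, X_comp]
    simp only [map_add, map_pow]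
    ring

lemma X_sub_mul_ascXSub_comp (j : ℕ) :
    ((X - C X) * ascXSub j).comp (1 + C (C q) * X) = ascXSub (j + 1) := by
  induction j with
  | zero => simp [ascXSub]; ring
  | succ j ih =>
    rw [ascXSub_succ, ← mul_assoc, mul_comp, ih, ascXSub_succ (j + 1), qInt_succ (j + 1)]
    simp only [add_comp, mul_comp, C_comp, X_comp]
    simp only [map_add, map_pow, map_sub]
    ring

lemma CC_q_pow (n : ℕ) :
    (C (C (q ^ n)) : K[X][X]) = 1 + C (C (q - 1)) * C (C (qInt n)) := by
  rw [q_pow_eq]; simp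

/-- The vanishing of `meanForm` at the `q`-difference of `x p_i (x - z) r_j`, where
`p_i = ascX i` and `r_j = ascXSub j`, written out with the `q`-Leibniz rule. -/
lemma meanForm_qLeibniz_left (i j : ℕ) :
    C (qInt (j + 1)) * meanForm (ascX (i + 1) * ascXSub j) +
      C (qInt (i + 1)) * meanForm ((X - C X) * (ascX i * ascXSub j)) = 0 := by
  have h := meanForm_eq_zero (g := (X * ascX i) * ((X - C X) * ascXSub j))
    (F := (C (qInt (j + 1)) : K[X]) • (ascX (i + 1) * ascXSub j) +
      (C (qInt (i + 1)) : K[X]) • ((X - C X) * (ascX i * ascXSub j))) (by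
    rw [mul_comp, X_mul_ascX_comp, X_sub_mul_ascXSub_comp, ascX_succ, ascXSub_succ,
      CC_q_pow, CC_q_pow]
    simp only [smul_eq_C_mul, map_sub]
    ring) (by simp) (by simp)
  simpa using h

/-- The same `q`-difference as in `meanForm_qLeibniz_left`, with the roles of the two factors in
the `q`-Leibniz rule exchanged. -/
lemma meanForm_qLeibniz_right (i j : ℕ) :
    C (qInt (i + 1)) * meanForm (ascX i * ascXSub (j + 1)) +
      C (qInt (j + 1)) * meanForm (X * (ascX i * ascXSub j)) = 0 := by
  have h := meanForm_eq_zero (g := (X * ascX i) * ((X - C X) * ascXSub j))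
    (F := (C (qInt (i + 1)) : K[X]) • (ascX i * ascXSub (j + 1)) +
      (C (qInt (j + 1)) : K[X]) • (X * (ascX i * ascXSub j))) (by
    rw [mul_comp, X_mul_ascX_comp, X_sub_mul_ascXSub_comp, ascX_succ, ascXSub_succ,
      CC_q_pow, CC_q_pow]
    simp only [smul_eq_C_mul, map_sub]
    ring) (by simp) (by simp)
  simpa using h

lemma meanForm_succ_left (i j : ℕ) :
    C (qInt (i + j + 2)) * meanForm (ascX (i + 1) * ascXSub j) =
      C (qInt (i + 1)) * (C (qInt (i + 1)) + C (q ^ (i + 1)) * X) *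
        meanForm (ascX i * ascXSub j) := by
  have h := meanForm_qLeibniz_left i j
  have hp : ascX (i + 1) * ascXSub j =
      (C (qInt (i + 1)) + C (q ^ (i + 1)) * X : K[X]) • (ascX i * ascXSub j) +
        (C (q ^ (i + 1)) : K[X]) • ((X - C X) * (ascX i * ascXSub j)) := by
    rw [ascX_succ]
    simp only [smul_eq_C_mul, map_add, map_mul]
    ring
  have hp' := congrArg meanForm hp
  rw [map_add, map_smul, map_smul, smul_eq_mul, smul_eq_mul] at hp'
  have hq : (C (qInt (i + j + 2)) : K[X]) =
      C (qInt (i + 1)) + C (q ^ (i + 1)) * C (qInt (j + 1)) := by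
    rw [← C_mul, ← C_add, ← qInt_add]; congr 2; ring
  rw [hq]
  linear_combination C (q ^ (i + 1)) * h + C (qInt (i + 1)) * hp'

lemma meanForm_succ_right (i j : ℕ) :
    C (qInt (i + j + 2)) * meanForm (ascX i * ascXSub (j + 1)) =
      C (qInt (j + 1)) * (C (qInt (j + 1)) - X) * meanForm (ascX i * ascXSub j) := by
  have h := meanForm_qLeibniz_right i j
  have hp : ascX i * ascXSub (j + 1) =
      (C (qInt (j + 1)) - X : K[X]) • (ascX i * ascXSub j) +
        (C (q ^ (j + 1)) : K[X]) • (X * (ascX i * ascXSub j)) := by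
    rw [ascXSub_succ]
    simp only [smul_eq_C_mul, map_sub]
    ring
  have hp' := congrArg meanForm hp
  rw [map_add, map_smul, map_smul, smul_eq_mul, smul_eq_mul] at hp'
  have hq : (C (qInt (i + j + 2)) : K[X]) =
      C (qInt (j + 1)) + C (q ^ (j + 1)) * C (qInt (i + 1)) := by
    rw [← C_mul, ← C_add, ← qInt_add]; congr 2; ring
  rw [hq]
  linear_combination C (q ^ (j + 1)) * h + C (qInt (j + 1)) * hp'

lemma C_mul_C_inv {a : K} (ha : a ≠ 0) : (C a * C a⁻¹ : K[X]) = 1 := by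
  rw [← C_mul, mul_inv_cancel₀ ha, C_1]

lemma meanForm_one : meanForm 1 = 1 := by
  have h := X_mul_meanForm 1
  have h1 : (C (C q) * (1 : K[X][X]).comp (1 + C (C q) * X) - 1) = (C (q - 1) : K[X]) • 1 := by
    simp [smul_eq_C_mul]
  rw [h1, map_smul, eval_one, eval_one, smul_eq_mul] at h
  have hC : (C (q - 1) : K[X]) ≠ 0 := C_ne_zero.mpr q_sub_one_ne_zero
  apply mul_left_cancel₀ (mul_ne_zero X_ne_zero hC)
  linear_combination h

/-- The finite form of the `q`-beta integral. -/
theorem meanForm_ascX_mul_ascXSub (i j : ℕ) :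
    meanForm (ascX i * ascXSub j) =
      C (qFact i) * Asc i * (C (qFact j) * Desc j) * C (qFact (i + j + 1))⁻¹ := by
  have hmul : C (qFact (i + j + 1)) * meanForm (ascX i * ascXSub j) =
      C (qFact i) * Asc i * (C (qFact j) * Desc j) := by
    induction i with
    | zero =>
      induction j with
      | zero => simp [meanForm_one, Asc, Desc]
      | succ j ih =>
        have h := meanForm_succ_right 0 j
        have e : 0 + (j + 1) + 1 = (0 + j + 1) + 1 := by ring
        rw [e, qFact_succ, qFact_succ j, Desc_succ]
        simp only [C_mul]
        linear_combination C (qFact (0 + j + 1)) * h +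
          C (qInt (j + 1)) * (C (qInt (j + 1)) - X) * ih
    | succ i ih =>
      have h := meanForm_succ_left i j
      have e : i + 1 + j + 1 = (i + j + 1) + 1 := by ring
      rw [e, qFact_succ, qFact_succ i, Asc_succ]
      simp only [C_mul]
      linear_combination C (qFact (i + j + 1)) * h +
          C (qInt (i + 1)) * (C (qInt (i + 1)) + C (q ^ (i + 1)) * X) * ih
  rw [← hmul]
  linear_combination -meanForm (ascX i * ascXSub j) * C_mul_C_inv (qFact_ne_zero (i + j + 1))

theorem meanForm_X_mul_ascX_mul_ascXSub (i j : ℕ) :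
    meanForm (X * (ascX i * ascXSub j)) =
      C (qFact (i + 1)) * Asc i * (-(C (qFact j) * Desc (j + 1))) * C (qFact (i + j + 2))⁻¹ := by
  have h := meanForm_qLeibniz_right i j
  rw [meanForm_ascX_mul_ascXSub] at h
  apply mul_left_cancel₀ (C_ne_zero.mpr (qInt_succ_ne_zero j))
  rw [qFact_succ i]
  rw [qFact_succ j] at h
  simp only [C_mul] at h ⊢
  linear_combination h

lemma natDegree_coeff_prod_linear {R : Type*} [CommRing R] (a b : ℕ → R) (n : ℕ) :
    (∏ k ∈ Finset.range n, (C (a k) * X + C (b k))).natDegree ≤ n ∧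
      (∏ k ∈ Finset.range n, (C (a k) * X + C (b k))).coeff n = ∏ k ∈ Finset.range n, a k := by
  constructor
  · refine (natDegree_prod_le _ _).trans ?_
    refine (Finset.sum_le_card_nsmul _ _ 1 fun k _ => natDegree_linear_le).trans ?_
    simp
  · have := coeff_prod_of_natDegree_le (Finset.range n)
      (fun k => C (a k) * X + C (b k)) 1 fun k _ => natDegree_linear_le
    simpa using this

/-! ### The Hankel determinant of inverse `q`-factorials -/

lemma choose_succ_two (n : ℕ) : (n + 1).choose 2 = n.choose 2 + n := by
  rw [Nat.choose_succ_succ' n 1, Nat.choose_one_right, add_comm]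

/-- The pivots of the Hankel matrix of the sequence `1 / [m + k + 1]!_q`. -/
def invFactPivot (k i : ℕ) : K :=
  (-1) ^ i * q ^ (i.choose 2 + i * (i + k + 1)) * (qFact i * qFact (i + k)) /
    (qFact (2 * i + k) * qFact (2 * i + k + 1))

/-- The quotient of the Hankel determinants of order `n` of the sequences `1 / [m + k + 2]!_q` and
`1 / [m + k + 1]!_q`. -/
def invFactRatio (k n : ℕ) : K := q ^ n.choose 2 * qFact (n + k) / qFact (2 * n + k)

lemma invFactPivot_ne_zero (k i : ℕ) : invFactPivot k i ≠ 0 := by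
  simp [invFactPivot, qFact_ne_zero, q_ne_zero]

lemma prod_invFactPivot_succ (k n : ℕ) :
    ∏ i ∈ Finset.range n, invFactPivot (k + 1) i =
      invFactRatio k n * ∏ i ∈ Finset.range n, invFactPivot k i := by
  induction n with
  | zero => simp [invFactRatio, qFact_ne_zero]
  | succ n ih =>
    rw [Finset.prod_range_succ, Finset.prod_range_succ, ih]
    have h : invFactRatio k n * invFactPivot (k + 1) n =
        invFactRatio k (n + 1) * invFactPivot k n := by
      simp only [invFactRatio, invFactPivot]
      have h1 := qFact_ne_zero (2 * n + k)
      have h2 := qInt_succ_ne_zero (2 * n + k)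
      have h3 := qInt_succ_ne_zero (2 * n + k + 1)
      rw [show 2 * (n + 1) + k = 2 * n + k + 1 + 1 by ring,
        show 2 * n + (k + 1) = 2 * n + k + 1 by ring, show n + 1 + k = n + k + 1 by ring,
        show n + (k + 1) = n + k + 1 by ring, choose_succ_two,
        show n.choose 2 + n * (n + k + 1 + 1) = n.choose 2 + n * (n + k + 1) + n by ring,
        qFact_succ (2 * n + k + 1), qFact_succ (2 * n + k), qFact_succ (n + k), pow_add _ _ n,
        pow_add q (n.choose 2) n]
      field_simp
    linear_combination (∏ i ∈ Finset.range n, invFactPivot k i) * h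

/-- The condensation of Hankel determinants for the sequence `1 / [m + k + 1]!_q`, divided by the
common factors of its three terms. -/
lemma invFact_rel (k n : ℕ) :
    invFactPivot k (n + 1) * invFactRatio k n * invFactRatio (k + 1) n =
      invFactPivot k n * invFactRatio k (n + 1) *
        (invFactRatio (k + 1) (n + 1) - invFactRatio k (n + 1)) := by
  have h1 := qFact_ne_zero (2 * n + k)
  have h2 := qInt_succ_ne_zero (2 * n + k)
  have h3 := qInt_succ_ne_zero (2 * n + k + 1)
  have h4 := qInt_succ_ne_zero (2 * n + k + 1 + 1)
  have h5 : qInt (n + k + 1 + 1) =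
      qInt (2 * n + k + 1 + 1 + 1) - q ^ n * q ^ k * q ^ 2 * qInt (n + 1) := by
    rw [show 2 * n + k + 1 + 1 + 1 = (n + k + 1 + 1) + (n + 1) by ring, qInt_add (n + k + 1 + 1)]
    ring
  simp only [invFactRatio, invFactPivot]
  rw [show 2 * (n + 1) + k = 2 * n + k + 1 + 1 by ring,
    show 2 * (n + 1) + (k + 1) = 2 * n + k + 1 + 1 + 1 by ring,
    show 2 * n + (k + 1) = 2 * n + k + 1 by ring, show n + 1 + k = n + k + 1 by ring,
    show n + 1 + (k + 1) = n + k + 1 + 1 by ring,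
    show n + (k + 1) = n + k + 1 by ring, choose_succ_two,
    show n.choose 2 + n + (n + 1) * (n + k + 1 + 1) =
      (n.choose 2 + n * (n + k + 1)) + (n + n + n + k + 2) by ring,
    qFact_succ (2 * n + k + 1 + 1), qFact_succ (2 * n + k + 1), qFact_succ (2 * n + k),
    qFact_succ (n + k + 1), qFact_succ (n + k), qFact_succ n,
    pow_add q (n.choose 2 + n * (n + k + 1)), h5, pow_add q (n.choose 2) n]
  simp only [pow_add, pow_one]
  field_simp
  ring

theorem hankelDet_inv_qFact (n : ℕ) : ∀ k, hankelDet (fun m => (qFact (m + k + 1))⁻¹) n =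
    ∏ i ∈ Finset.range n, invFactPivot k i := by
  induction n using Nat.strong_induction_on with
  | _ n ih =>
    rcases n with _ | _ | n
    · simp
    · intro k
      simp [hankelDet, invFactPivot]
      field_simp [qFact_ne_zero]
    · intro k
      have h := hankelDet_condensation (fun m => (qFact (m + k + 1))⁻¹) n
      have e2 : (fun m => (qFact (m + 2 + k + 1))⁻¹) =
          fun m => (qFact (m + (k + 1 + 1) + 1))⁻¹ := by
        ext m; congr 2; ring
      have e1 : (fun m => (qFact (m + 1 + k + 1))⁻¹) =
          fun m => (qFact (m + (k + 1) + 1))⁻¹ := by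
        ext m; congr 2; ring
      rw [e1, e2, ih n (by omega), ih (n + 1) (by omega), ih (n + 1) (by omega),
        ih (n + 1) (by omega), prod_invFactPivot_succ (k + 1), prod_invFactPivot_succ (k + 1),
        prod_invFactPivot_succ k, prod_invFactPivot_succ k] at h
      have hne : invFactRatio (k + 1) n *
          (invFactRatio k n * ∏ i ∈ Finset.range n, invFactPivot k i) ≠ 0 := by
        simp [invFactRatio, qFact_ne_zero, q_ne_zero, Finset.prod_eq_zero_iff,
          invFactPivot_ne_zero]
      apply mul_right_cancel₀ hne
      rw [h, Finset.prod_range_succ _ (n + 1), Finset.prod_range_succ]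
      linear_combination -(∏ i ∈ Finset.range n, invFactPivot k i) ^ 2 * invFactPivot k n *
        invFact_rel k n

/-! ### Product formulas for the first two Hankel determinants -/

/-- The product of the coefficients of degree `i` of `ascX i` and `ascXSub i`. -/
lemma coeff_ascX_mul_coeff_ascXSub (i : ℕ) :
    (ascX i).coeff i * (ascXSub i).coeff i = C (q ^ (i * (i + 1))) := by
  rw [ascX, ascXSub, (natDegree_coeff_prod_linear _ _ i).2, (natDegree_coeff_prod_linear _ _ i).2,
    ← map_prod, ← C_mul]
  congr 1
  induction i with
  | zero => simp
  | succ i ih =>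
    rw [Finset.prod_range_succ, mul_mul_mul_comm, ih]
    ring

lemma det_mul_mul_hankel {R : Type*} [CommRing R] (u v s : ℕ → R) (n : ℕ) :
    Matrix.det (Matrix.of fun i j : Fin n => u i * v j * s (i + j)) =
      (∏ i ∈ Finset.range n, u i * v i) * hankelDet s n := by
  have h1 := Matrix.det_mul_row (fun j : Fin n => v j) (Matrix.of fun i j : Fin n => s (i + j))
  have h2 := Matrix.det_mul_column (fun i : Fin n => u i)
    (Matrix.of fun i j : Fin n => v j * Matrix.of (fun i j : Fin n => s (i + j)) i j)
  rw [h1] at h2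
  rw [Finset.prod_range, Finset.prod_mul_distrib, hankelDet, mul_assoc, ← h2]
  congr 1
  ext i j
  simp [mul_assoc]

/-- A linear form whose values on the products of the two triangular families are, up to row and
column factors, inverse `q`-factorials, has its Hankel determinant in product form. -/
lemma hankelDet_of_apply_eq (L : K[X][X] →ₗ[K[X]] K[X]) (u v : ℕ → K[X]) (k : ℕ)
    (hL : ∀ i j, L (ascX i * ascXSub j) = u i * v j * C (qFact (i + j + k + 1))⁻¹) (n : ℕ) :
    hankelDet (fun m => L (X ^ m)) n =
      ∏ i ∈ Finset.range n, u i * v i * C (invFactPivot k i * (q ^ (i * (i + 1)))⁻¹) := by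
  have h := det_apply_mul_eq L ascX ascXSub (fun i => (natDegree_coeff_prod_linear _ _ i).1)
    (fun i => (natDegree_coeff_prod_linear _ _ i).1) n
  simp only [hL, coeff_ascX_mul_coeff_ascXSub] at h
  rw [det_mul_mul_hankel u v (fun m => C (qFact (m + k + 1))⁻¹), ← map_hankelDet,
    hankelDet_inv_qFact, map_prod, ← Finset.prod_mul_distrib] at h
  have hne : ∏ i ∈ Finset.range n, (C (q ^ (i * (i + 1))) : K[X]) ≠ 0 :=
    Finset.prod_ne_zero_iff.mpr fun i _ => C_ne_zero.mpr (pow_ne_zero _ q_ne_zero)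
  apply mul_left_cancel₀ hne
  rw [← h, ← Finset.prod_mul_distrib]
  refine Finset.prod_congr rfl fun i _ => ?_
  rw [C_mul (a := invFactPivot k i)]
  linear_combination -u i * v i * C (invFactPivot k i) *
    C_mul_C_inv (pow_ne_zero (i * (i + 1)) q_ne_zero)

/-- The quotient of consecutive Hankel determinants of the sequence `β_m`. -/
def pivot₀ (i : ℕ) : K :=
  (-1) ^ i * q ^ i.choose 2 * (qFact i ^ 6 / (qFact (2 * i) * qFact (2 * i + 1)))

/-- The quotient of consecutive Hankel determinants of the sequence `β_{m+1}`. -/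
def pivot₁ (i : ℕ) : K :=
  (-1) ^ (i + 1) * q ^ (i + 1).choose 2 *
    (qFact i ^ 3 * qFact (i + 1) ^ 3 / (qFact (2 * i + 1) * qFact (2 * i + 2)))

theorem hankelDet_mean_betaPoly (n : ℕ) : hankelDet (fun m => mean (betaPoly m)) n =
    ∏ i ∈ Finset.range n, C ((-1) ^ i * q ^ i.choose 2) *
      (C (qFact i ^ 4 / (qFact (2 * i) * qFact (2 * i + 1))) * Asc i * Desc i) := by
  have h := hankelDet_of_apply_eq meanForm _ _ 0 meanForm_ascX_mul_ascXSub n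
  simp only [meanForm_X_pow] at h
  rw [h]
  refine Finset.prod_congr rfl fun i _ => ?_
  have hc : (-1) ^ i * q ^ i.choose 2 * (qFact i ^ 4 / (qFact (2 * i) * qFact (2 * i + 1))) =
      qFact i * qFact i * (invFactPivot 0 i * (q ^ (i * (i + 1)))⁻¹) := by
    simp only [invFactPivot, add_zero, pow_add]
    field_simp [q_ne_zero, qFact_ne_zero]
  have hc' := congrArg (C : K → K[X]) hc
  simp only [C_mul (R := K)] at hc' ⊢
  linear_combination -Asc i * Desc i * hc'

theorem hankelDet_mean_betaPoly_succ (n : ℕ) :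
    hankelDet (fun m => mean (betaPoly (m + 1))) n =
      ∏ i ∈ Finset.range n, C (qFact (i + 1)) * Asc i * (-(C (qFact i) * Desc (i + 1))) *
        C (invFactPivot 1 i * (q ^ (i * (i + 1)))⁻¹) := by
  have h := hankelDet_of_apply_eq (meanForm ∘ₗ LinearMap.mulLeft K[X] X) _ _ 1
    meanForm_X_mul_ascX_mul_ascXSub n
  simpa only [LinearMap.comp_apply, LinearMap.mulLeft_apply, ← pow_succ', meanForm_X_pow] using h

lemma eval_zero_mean (p : K[X]) : (mean p).eval 0 = p.eval 0 := by
  have h := congrArg (fun r => (derivative r).eval 0) (X_mul_mean p)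
  simpa [derivative_integral] using h

lemma eval_zero_betaPoly (n : ℕ) : (betaPoly n).eval 0 = beta n := by
  have h : ∀ f : K[X][X], (Psi K[X] f).eval 0 = Psi K (f.map (evalRingHom 0)) := by
    intro f
    induction f using Polynomial.induction_on' with
    | add f g hf hg => simp only [map_add, eval_add, hf, hg, Polynomial.map_add]
    | monomial n a =>
      simp [Psi, Polynomial.lsum_apply, Polynomial.sum_monomial_index]
  rw [betaPoly, h, ← Psi_X_pow]
  simp

theorem hankelDet_beta (n : ℕ) : hankelDet beta n = ∏ i ∈ Finset.range n, pivot₀ i := by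
  have h := congrArg (evalRingHom 0) (hankelDet_mean_betaPoly n)
  rw [map_hankelDet] at h
  simp only [coe_evalRingHom, eval_zero_mean, eval_zero_betaPoly] at h
  rw [h, eval_prod]
  refine Finset.prod_congr rfl fun i _ => ?_
  simp only [eval_mul, eval_C, eval_zero_Asc, eval_zero_Desc, pivot₀]
  ring

theorem hankelDet_beta_succ (n : ℕ) :
    hankelDet (fun m => beta (m + 1)) n = ∏ i ∈ Finset.range n, pivot₁ i := by
  have h := congrArg (evalRingHom 0) (hankelDet_mean_betaPoly_succ n)
  rw [map_hankelDet] at h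
  simp only [coe_evalRingHom, eval_zero_mean, eval_zero_betaPoly] at h
  rw [h, eval_prod]
  refine Finset.prod_congr rfl fun i _ => ?_
  simp only [eval_mul, eval_neg, eval_C, eval_zero_Asc, eval_zero_Desc, pivot₁, invFactPivot,
    choose_succ_two]
  rw [show i.choose 2 + i * (i + 1 + 1) = i.choose 2 + i + i * (i + 1) by ring,
    pow_add _ (i.choose 2 + i)]
  field_simp [q_ne_zero, qFact_ne_zero]
  ring

/-! ### Condensation for the next two Hankel determinants -/

/-- If `a` is the quotient of consecutive Hankel determinants of `s`, and `g` is the quotient of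
those of the shifted sequence by those of `s`, then condensation determines the quotient `h` for
the next shift recursively. -/
lemma hankelDet_shift_two {F : Type*} [Field F] (s a g h : ℕ → F)
    (ha : ∀ n, hankelDet s n = ∏ i ∈ Finset.range n, a i) (ha0 : ∀ n, a n ≠ 0)
    (hg : ∀ n, hankelDet (fun m => s (m + 1)) n = g n * hankelDet s n) (h0 : h 0 = 1)
    (hrel : ∀ n, a n * g (n + 1) * (h (n + 1) - g (n + 1)) = a (n + 1) * g n * h n) (n : ℕ) :
    hankelDet (fun m => s (m + 2)) n = h n * hankelDet (fun m => s (m + 1)) n := by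
  induction n with
  | zero => simp [h0]
  | succ n ih =>
    have hc := hankelDet_condensation s n
    have hs : ∀ n, hankelDet s (n + 1) = hankelDet s n * a n := fun n => by
      rw [ha, ha, Finset.prod_range_succ]
    have hne : hankelDet s n ≠ 0 := by
      rw [ha]; exact Finset.prod_ne_zero_iff.mpr fun i _ => ha0 i
    rw [ih, hg, hg, hs (n + 1), hs n] at hc
    rw [hg, hs]
    apply mul_left_cancel₀ (mul_ne_zero hne (ha0 n))
    linear_combination -hc - hankelDet s n ^ 2 * a n * hrel n

lemma mul_prod_range_eq {F : Type*} [CommRing F] (t c d : ℕ → F)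
    (h : ∀ n, t (n + 1) * c n = t n * d n) (n : ℕ) :
    t n * ∏ i ∈ Finset.range n, c i = t 0 * ∏ i ∈ Finset.range n, d i := by
  induction n with
  | zero => simp
  | succ n ih =>
    rw [Finset.prod_range_succ, Finset.prod_range_succ]
    linear_combination (∏ i ∈ Finset.range n, c i) * h n + d n * ih

/-- The quotient of the Hankel determinants of order `n` of `β_{m+1}` and `β_m`. -/
def ratio₁ (n : ℕ) : K := (-1) ^ n * q ^ n.choose 2 * qFact n ^ 3 / qFact (2 * n)

/-- The quotient of the Hankel determinants of order `n` of `β_{m+2}` and `β_{m+1}`. -/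
def ratio₂ (n : ℕ) : K :=
  (-1) ^ n * q ^ (n + 1).choose 2 * (qFact n ^ 2 * qFact (n + 1)) / qFact (2 * n + 1)

/-- The factorial part of the quotient of the Hankel determinants of order `n` of `β_{m+3}`
and `β_{m+2}`. -/
def ratio₃ (n : ℕ) : K := (-1) ^ n * (qFact n * qFact (n + 1) ^ 2) / qFact (2 * n + 2)

/-- The quotient of consecutive Hankel determinants of the sequence `β_{m+2}`. -/
def pivot₂ (i : ℕ) : K :=
  (-1) ^ i * q ^ (i + 2).choose 2 * (qFact i * qFact (i + 1) ^ 4 * qFact (i + 2) /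
    (qFact (2 * i + 2) * qFact (2 * i + 3)))

/-- The factor of hypergeometric type in the quotient of consecutive Hankel determinants of the
sequence `β_{m+3}`. -/
def pivot₃ (i : ℕ) : K :=
  (-1) ^ (i + 1) * q ^ (i + 2).choose 2 * (qFact (i + 1) ^ 3 * qFact (i + 2) ^ 3 /
    (qFact (2 * i + 3) * qFact (2 * i + 4)))

lemma pivot₀_ne_zero (i : ℕ) : pivot₀ i ≠ 0 := by
  simp [pivot₀, qFact_ne_zero, q_ne_zero]

lemma pivot₁_ne_zero (i : ℕ) : pivot₁ i ≠ 0 := by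
  simp [pivot₁, qFact_ne_zero, q_ne_zero]

lemma ratio₁_succ (n : ℕ) : ratio₁ (n + 1) * pivot₀ n = ratio₁ n * pivot₁ n := by
  have h1 := qFact_ne_zero (2 * n)
  have h2 := qInt_succ_ne_zero (2 * n)
  have h3 := qInt_succ_ne_zero (2 * n + 1)
  simp only [ratio₁, pivot₀, pivot₁, choose_succ_two]
  rw [show 2 * (n + 1) = 2 * n + 1 + 1 by ring, qFact_succ (2 * n + 1), qFact_succ (2 * n),
    qFact_succ n]
  simp only [pow_add, pow_one]
  field_simp

lemma ratio₂_succ (n : ℕ) : ratio₂ (n + 1) * pivot₁ n = ratio₂ n * pivot₂ n := by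
  have h1 := qFact_ne_zero (2 * n)
  have h2 := qInt_succ_ne_zero (2 * n)
  have h3 := qInt_succ_ne_zero (2 * n + 1)
  have h4 := qInt_succ_ne_zero (2 * n + 1 + 1)
  simp only [ratio₂, pivot₁, pivot₂, choose_succ_two]
  rw [show 2 * (n + 1) + 1 = 2 * n + 1 + 1 + 1 by ring, qFact_succ (2 * n + 1 + 1),
    qFact_succ (2 * n + 1), qFact_succ (2 * n), qFact_succ (n + 1), qFact_succ n]
  simp only [pow_add, pow_one]
  field_simp

lemma ratio₃_succ (n : ℕ) : ratio₃ (n + 1) * pivot₂ n = ratio₃ n * pivot₃ n := by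
  have h1 := qFact_ne_zero (2 * n)
  have h2 := qInt_succ_ne_zero (2 * n)
  have h3 := qInt_succ_ne_zero (2 * n + 1)
  have h4 := qInt_succ_ne_zero (2 * n + 1 + 1)
  have h5 := qInt_succ_ne_zero (2 * n + 1 + 1 + 1)
  simp only [ratio₃, pivot₂, pivot₃, choose_succ_two]
  rw [show 2 * (n + 1) + 2 = 2 * n + 1 + 1 + 1 + 1 by ring, qFact_succ (2 * n + 1 + 1 + 1),
    qFact_succ (2 * n + 1 + 1),
    qFact_succ (2 * n + 1), qFact_succ (2 * n), qFact_succ (n + 1), qFact_succ n]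
  simp only [pow_add, pow_one]
  field_simp

/-- The condensation of Hankel determinants for the sequence `β_m`, divided by the common factors
of its three terms. -/
lemma condensation_rel₂ (n : ℕ) :
    pivot₀ n * ratio₁ (n + 1) * (ratio₂ (n + 1) - ratio₁ (n + 1)) =
      pivot₀ (n + 1) * ratio₁ n * ratio₂ n := by
  have h1 := qFact_ne_zero (2 * n)
  have h2 := qInt_succ_ne_zero (2 * n)
  have h3 := qInt_succ_ne_zero (2 * n + 1)
  have h4 := qInt_succ_ne_zero (2 * n + 1 + 1)
  have h5 : qInt (n + 1) = qInt (2 * n + 1 + 1 + 1) - q ^ n * q * qInt (n + 1 + 1) := by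
    rw [show 2 * n + 1 + 1 + 1 = (n + 1) + (n + 1 + 1) by ring, qInt_add (n + 1)]
    ring
  simp only [ratio₁, ratio₂, pivot₀, choose_succ_two]
  rw [show 2 * (n + 1) + 1 = 2 * n + 1 + 1 + 1 by ring, show 2 * (n + 1) = 2 * n + 1 + 1 by ring,
    qFact_succ (2 * n + 1 + 1), qFact_succ (2 * n + 1), qFact_succ (2 * n),
    qFact_succ (n + 1), qFact_succ n]
  simp only [pow_add, pow_one]
  generalize qInt (n + 1 + 1) = j at *
  generalize qInt (n + 1) = i at *
  generalize qInt (2 * n + 1 + 1 + 1) = l at *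
  subst h5
  field_simp
  ring

/-- The condensation of Hankel determinants for the sequence `β_{m+1}`, divided by the common factors
of its three terms. -/
lemma condensation_rel₃ (n : ℕ) :
    pivot₁ n * ratio₂ (n + 1) *
        ((q ^ (n + 1 + 2).choose 2 + (-1) ^ (n + 1)) * ratio₃ (n + 1) - ratio₂ (n + 1)) =
      pivot₁ (n + 1) * ratio₂ n * ((q ^ (n + 2).choose 2 + (-1) ^ n) * ratio₃ n) := by
  have h1 := qFact_ne_zero (2 * n)
  have h2 := qInt_succ_ne_zero (2 * n)
  have h3 := qInt_succ_ne_zero (2 * n + 1)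
  have h4 := qInt_succ_ne_zero (2 * n + 1 + 1)
  have h6 := qInt_succ_ne_zero (n + 1)
  have h7 := qInt_succ_ne_zero (2 * n + 1 + 1 + 1)
  have h5 : qInt (2 * n + 1 + 1 + 1 + 1) = (1 + q ^ n * q ^ 2) * qInt (n + 1 + 1) := by
    rw [show 2 * n + 1 + 1 + 1 + 1 = (n + 1 + 1) + (n + 1 + 1) by ring, qInt_add (n + 1 + 1)]
    ring
  simp only [ratio₃, ratio₂, pivot₁, choose_succ_two]
  rw [show 2 * (n + 1) + 2 = 2 * n + 1 + 1 + 1 + 1 by ring,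
    show 2 * (n + 1) + 1 = 2 * n + 1 + 1 + 1 by ring,
    qFact_succ (2 * n + 1 + 1 + 1),
    qFact_succ (2 * n + 1 + 1), qFact_succ (2 * n + 1), qFact_succ (2 * n),
    qFact_succ (n + 1), qFact_succ n]
  simp only [pow_add, pow_one]
  -- `[2n + 4]_q` has the factor `[n + 2]_q`, which cancels; the sign is then fixed so that
  -- `(-1) ^ n` squares to `1`.
  rw [h5] at h7 ⊢
  have h8 := left_ne_zero_of_mul h7
  rcases neg_one_pow_eq_or K n with hs | hs <;> rw [hs] <;> field_simp <;> ring

theorem hankelDet_beta_succ_eq (n : ℕ) :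
    hankelDet (fun m => beta (m + 1)) n = ratio₁ n * hankelDet beta n := by
  rw [hankelDet_beta, hankelDet_beta_succ, mul_prod_range_eq _ _ _ ratio₁_succ]
  simp [ratio₁]

theorem hankelDet_beta_add_two_eq (n : ℕ) :
    hankelDet (fun m => beta (m + 2)) n = ratio₂ n * hankelDet (fun m => beta (m + 1)) n :=
  hankelDet_shift_two beta pivot₀ ratio₁ ratio₂ hankelDet_beta pivot₀_ne_zero
    hankelDet_beta_succ_eq (by simp [ratio₂]) condensation_rel₂ n

theorem hankelDet_beta_add_two (n : ℕ) :
    hankelDet (fun m => beta (m + 2)) n = ∏ i ∈ Finset.range n, pivot₂ i := by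
  rw [hankelDet_beta_add_two_eq, hankelDet_beta_succ, mul_prod_range_eq _ _ _ ratio₂_succ]
  simp [ratio₂]

theorem hankelDet_beta_add_three (n : ℕ) : hankelDet (fun m => beta (m + 3)) n =
    (q ^ (n + 2).choose 2 + (-1) ^ n) * ((qInt 2)⁻¹ * ∏ i ∈ Finset.range n, pivot₃ i) := by
  have h := hankelDet_shift_two (fun m => beta (m + 1)) pivot₁ ratio₂
    (fun n => (q ^ (n + 2).choose 2 + (-1) ^ n) * ratio₃ n) hankelDet_beta_succ pivot₁_ne_zero
    hankelDet_beta_add_two_eq ?_ condensation_rel₃ n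
  · have h0 : ratio₃ 0 = (qInt 2)⁻¹ := by simp [ratio₃, qFact_succ 1]
    rw [← h0, ← mul_prod_range_eq _ _ _ ratio₃_succ, ← hankelDet_beta_add_two, ← mul_assoc]
    exact h
  · have h2 : qInt 2 = q + 1 := by rw [qInt_succ 1]; simp [add_comm]
    simp only [ratio₃, zero_add, Nat.choose_self, pow_one, pow_zero, one_mul, qFact_zero,
      qFact_one, one_pow, mul_zero, qFact_succ 1, Nat.reduceAdd]
    rw [← h2]
    exact mul_one_div_cancel (qInt_succ_ne_zero 1)

/-! ### The determinants in closed form -/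

lemma prod_range_eq_mul_prod_Icc {M : Type*} [CommMonoid M] (f : ℕ → M) {n : ℕ} (hn : 1 ≤ n) :
    ∏ i ∈ Finset.range n, f i = f 0 * ∏ i ∈ Finset.Icc 1 (n - 1), f i := by
  obtain ⟨m, rfl⟩ := Nat.exists_eq_add_of_le' hn
  rw [Finset.prod_range_succ', mul_comm, Finset.range_eq_Ico, Finset.prod_Ico_add' f 0 m 1]
  rfl

lemma prod_range_eq_prod_Icc {M : Type*} [CommMonoid M] (f : ℕ → M) (h0 : f 0 = 1) (n : ℕ) :
    ∏ i ∈ Finset.range n, f i = ∏ i ∈ Finset.Icc 1 (n - 1), f i := by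
  rcases n with _ | n
  · simp
  · rw [prod_range_eq_mul_prod_Icc f (by omega), h0, one_mul]

lemma prod_pow_choose_two (a : K) (k n : ℕ) :
    ∏ i ∈ Finset.range n, a ^ (i + k).choose 2 = a ^ ((n + k).choose 3 - k.choose 3) := by
  rw [Finset.prod_pow_eq_pow_sum]
  congr 1
  apply Nat.eq_sub_of_add_eq
  induction n with
  | zero => simp
  | succ n ih =>
    have h : (n + k + 1).choose 3 = (n + k).choose 2 + (n + k).choose 3 :=
      Nat.choose_succ_succ' (n + k) 2
    rw [Finset.sum_range_succ, show n + 1 + k = n + k + 1 by ring, h]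
    omega

lemma prod_neg_one_pow (k n : ℕ) :
    ∏ i ∈ Finset.range n, (-1 : K) ^ (i + k) = (-1) ^ ((n + k).choose 2 - k.choose 2) := by
  rw [Finset.prod_pow_eq_pow_sum]
  congr 1
  apply Nat.eq_sub_of_add_eq
  induction n with
  | zero => simp
  | succ n ih =>
    rw [Finset.sum_range_succ, show n + 1 + k = n + k + 1 by ring, choose_succ_two (n + k)]
    omega

end QBernoulli

end

open QBernoulli in
theorem mainTheorem5 (n : ℕ) :
    Matrix.det (Matrix.of fun i j : Fin n => beta (i + j)) =
        (-1) ^ n.choose 2 * q ^ n.choose 3 *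
          ∏ i ∈ Finset.Icc 1 (n - 1), qFact i ^ 6 / (qFact (2 * i) * qFact (2 * i + 1)) ∧
    (1 ≤ n → Matrix.det (Matrix.of fun i j : Fin n => beta (i + j + 1)) =
        (-1) ^ (n + 1).choose 2 / qInt 2 * q ^ (n + 1).choose 3 *
          ∏ i ∈ Finset.Icc 1 (n - 1),
            qFact i ^ 3 * qFact (i + 1) ^ 3 / (qFact (2 * i + 1) * qFact (2 * i + 2))) ∧
    (1 ≤ n → Matrix.det (Matrix.of fun i j : Fin n => beta (i + j + 2)) =
        (-1) ^ n.choose 2 / (qInt 2 * qInt 3) * q ^ (n + 2).choose 3 *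
          ∏ i ∈ Finset.Icc 1 (n - 1),
            qFact i * qFact (i + 1) ^ 4 * qFact (i + 2) /
              (qFact (2 * i + 2) * qFact (2 * i + 3))) ∧
    (1 ≤ n → Matrix.det (Matrix.of fun i j : Fin n => beta (i + j + 3)) =
        (-1) ^ (n + 1).choose 2 / (qInt 3 ^ 2 * qInt 4) * q ^ (n + 2).choose 3 *
          (q ^ (n + 2).choose 2 + (-1) ^ n) *
          ∏ i ∈ Finset.Icc 1 (n - 1),
            qFact (i + 1) ^ 3 * qFact (i + 2) ^ 3 / (qFact (2 * i + 3) * qFact (2 * i + 4))) ∧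
    Matrix.det (Matrix.of fun i j : Fin n => mean (betaPoly (i + j))) =
      (-1) ^ n.choose 2 * Polynomial.C (q ^ n.choose 3) *
        ∏ i ∈ Finset.Icc 1 (n - 1),
          Polynomial.C (qFact i ^ 4 / (qFact (2 * i) * qFact (2 * i + 1))) * Asc i * Desc i := by
  have hq2 := qInt_succ_ne_zero 1
  have hq3 := qInt_succ_ne_zero 2
  have hq4 := qInt_succ_ne_zero 3
  have f2 : qFact 2 = qInt 2 := by rw [qFact_succ 1, qFact_one, one_mul]
  have f3 : qFact 3 = qInt 2 * qInt 3 := by rw [qFact_succ 2, f2]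
  have f4 : qFact 4 = qInt 2 * qInt 3 * qInt 4 := by rw [qFact_succ 3, f3]
  have sign₀ := prod_neg_one_pow 0 n
  have sign₁ := prod_neg_one_pow 1 n
  have pow₀ := prod_pow_choose_two q 0 n
  have pow₁ := prod_pow_choose_two q 1 n
  have pow₂ := prod_pow_choose_two q 2 n
  simp only [add_zero, Nat.choose_zero_succ, Nat.sub_zero] at sign₀ pow₀
  rw [show Nat.choose 1 2 = 0 from rfl, Nat.sub_zero] at sign₁
  rw [show Nat.choose 1 3 = 0 from rfl, Nat.sub_zero] at pow₁
  rw [show Nat.choose 2 3 = 0 from rfl, Nat.sub_zero] at pow₂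
  refine ⟨?_, fun hn => ?_, fun hn => ?_, fun hn => ?_, ?_⟩
  · refine (hankelDet_beta n).trans ?_
    simp only [pivot₀]
    rw [Finset.prod_mul_distrib, Finset.prod_mul_distrib, sign₀, pow₀,
      prod_range_eq_prod_Icc _ (by simp)]
  · refine (hankelDet_beta_succ n).trans ?_
    simp only [pivot₁]
    rw [Finset.prod_mul_distrib, Finset.prod_mul_distrib, sign₁, pow₁,
      prod_range_eq_mul_prod_Icc _ hn]
    simp only [mul_zero, zero_add, qFact_zero, qFact_one, f2]
    ring
  · refine (hankelDet_beta_add_two n).trans ?_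
    simp only [pivot₂]
    rw [Finset.prod_mul_distrib, Finset.prod_mul_distrib, sign₀, pow₂,
      prod_range_eq_mul_prod_Icc _ hn]
    simp only [mul_zero, zero_add, qFact_zero, qFact_one, f2, f3]
    field_simp
  · refine (hankelDet_beta_add_three n).trans ?_
    simp only [pivot₃]
    rw [Finset.prod_mul_distrib, Finset.prod_mul_distrib, sign₁, pow₂,
      prod_range_eq_mul_prod_Icc _ hn]
    simp only [mul_zero, zero_add, qFact_one, f2, f3, f4]
    field_simp
  · refine (hankelDet_mean_betaPoly n).trans ?_
    rw [Finset.prod_mul_distrib, ← map_prod, Finset.prod_mul_distrib, sign₀, pow₀,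
      prod_range_eq_prod_Icc _ (by simp [Asc, Desc])]
    simp
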